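/- **Convergence rate for convex functions.** Let $B$ be an $n\times n$ real symmetric positive semidefinite matrix with eigenvalues $\lambda_1\ge\dots\ge\lambda_n$ and spectral decomposition $B=Q\,\mathrm{Diag}(\lambda_1,\dots,\lambda_n)\,Q^T$, $Q$ orthogonal. For a symmetric positive semidefinite matrix $M$ put $\|v\|_M:=\langle Mv,v\rangle^{1/2}$. Let $1\le\tau\le\operatorname{rank}B$, and define the $\tau$-coordinate approximation of $B$ by $$B_\tau:=Q\,\mathrm{Diag}(\lambda_1,\dots,\lambda_\tau,\lambda_\tau,\dots,\lambda_\tau)\,Q^T+\Big(\sum_{i=\tau+1}^n\lambda_i\Big)I .$$ Let $f:\mathbb R^n\to\mathbb R$ be a convex differentiable function which is 1-smooth with respect to $\|\cdot\|_B$, that is, $$f(y)\le f(x)+\langle\nabla f(x),y-x\rangle+\tfrac12\|y-x\|_B^2\qquad\text{for all }x,y\in\mathbb R^n .$$ Let $x_0\in\mathbb R^n$ be a deterministic point such that the sublevel set $L_f(x_0):=\{x\in\mathbb R^n: f(x)\le f(x_0)\}$ is bounded. For a $\tau$-element set $S\subseteq\{1,\dots,n\}$, let $I_S$ be the $n\times\tau$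 matrix formed by the columns of the identity matrix with indices in $S$, and put $B_{S\times S}:=I_S^TBI_S$ and $v_S:=I_S^Tv$. Let $K\ge1$, let $S_0,\dots,S_{K-1}$ be independent random $\tau$-element subsets of $\{1,\dots,n\}$, each with the volume sampling law $$\Pr(S_k=S)=\frac{\det B_{S\times S}}{\sum_{|S'|=\tau}\det B_{S'\times S'}},$$ and let $$x_{k+1}:=x_k-I_{S_k}(B_{S_k\times S_k})^{-1}\nabla f(x_k)_{S_k},\qquad 0\le k\le K-1$$ (randomized coordinate descent with volume sampling; the matrices $B_{S_k\times S_k}$ are non-degenerate almost surely). Then $\min f$ is attained, the minima and the maximum in $$D_\tau:=\max_{x\in L_f(x_0)}\ \min_{x^*\in\operatorname{Argmin}f}\|x-x^*\|_{B_\tau}$$ are attained, $f(x_k)$ is integrable for all $0\le k\le K$, and $$\mathbb E f(x_k)-\min f\le\frac{2D_\tau^2}{k+1}\qquad\text{for all }0\le k\le K .$$ -/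

import Mathlib

open Matrix MeasureTheory ProbabilityTheory

noncomputable section

/-- The seminorm `‖v‖_M = ⟨M v, v⟩^{1/2}` induced by a symmetric positive semidefinite matrix `M`. -/
def matSeminorm {n : ℕ} (M : Matrix (Fin n) (Fin n) ℝ) (v : EuclideanSpace ℝ (Fin n)) : ℝ :=
  Real.sqrt ((M *ᵥ v.ofLp) ⬝ᵥ v.ofLp)

/-- `f` is differentiable and 1-smooth with respect to the seminorm `‖·‖_B`. -/
structure IsOneSmooth {n : ℕ} (f : EuclideanSpace ℝ (Fin n) → ℝ)
    (B : Matrix (Fin n) (Fin n) ℝ) : Prop where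
  differentiable : Differentiable ℝ f
  upper_bound : ∀ x y, f y ≤ f x + inner ℝ (gradient f x) (y - x) + 1 / 2 * matSeminorm B (y - x) ^ 2

/-- The sublevel set `L_f(x₀) = {x | f x ≤ f x₀}`. -/
def sublevelSet {n : ℕ} (f : EuclideanSpace ℝ (Fin n) → ℝ) (x₀ : EuclideanSpace ℝ (Fin n)) :
    Set (EuclideanSpace ℝ (Fin n)) :=
  {x | f x ≤ f x₀}

/-- The set of global minimizers of `f`. -/
def argminSet {n : ℕ} (f : EuclideanSpace ℝ (Fin n) → ℝ) : Set (EuclideanSpace ℝ (Fin n)) :=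
  {z | ∀ y, f z ≤ f y}

/-- `min f`, as the infimum of the values of `f` (meaningful when it is attained). -/
def minValue {n : ℕ} (f : EuclideanSpace ℝ (Fin n) → ℝ) : ℝ :=
  sInf (Set.range f)

/-! ### Volume sampling and the coordinate descent method -/

/-- The `τ`-element subsets of the index set `Fin n`. -/
abbrev TauSubset (n τ : ℕ) : Type := {T : Finset (Fin n) // T.card = τ}

/-- The principal submatrix `B_{T × T}`. -/
def principalSubmatrix {n : ℕ} (B : Matrix (Fin n) (Fin n) ℝ) (T : Finset (Fin n)) :
    Matrix T T ℝ :=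
  B.submatrix (fun i : T => (i : Fin n)) (fun i : T => (i : Fin n))

/-- The subvector `v_T`. -/
def subvector {n : ℕ} (T : Finset (Fin n)) (v : EuclideanSpace ℝ (Fin n)) : T → ℝ :=
  fun i => v (i : Fin n)

/-- The vector `I_T h`: extension of `h` by zero outside `T`. -/
def extendByZero {n : ℕ} (T : Finset (Fin n)) (h : T → ℝ) : EuclideanSpace ℝ (Fin n) :=
  WithLp.toLp 2 (fun i => if hi : i ∈ T then h ⟨i, hi⟩ else 0)

/-- One coordinate descent update `x - I_T (B_{T × T})⁻¹ ∇f(x)_T`. -/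
def coordStep {n : ℕ} (f : EuclideanSpace ℝ (Fin n) → ℝ) (B : Matrix (Fin n) (Fin n) ℝ)
    (T : Finset (Fin n)) (x : EuclideanSpace ℝ (Fin n)) : EuclideanSpace ℝ (Fin n) :=
  x - extendByZero T ((principalSubmatrix B T)⁻¹ *ᵥ subvector T (gradient f x))

/-- The random `τ`-element subset `S` is generated according to `τ`-element volume sampling with
respect to `B`: a measurable map whose law is proportional to the principal minors. -/
structure IsVolumeSample {Ω : Type*} [MeasurableSpace Ω] (P : Measure Ω) {n : ℕ}
    (B : Matrix (Fin n) (Fin n) ℝ) (τ : ℕ) (S : Ω → TauSubset n τ) : Prop where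
  measurable : Measurable S
  law : ∀ T : TauSubset n τ, P.real {ω | S ω = T} =
    (principalSubmatrix B T.1).det / ∑ T' : TauSubset n τ, (principalSubmatrix B T'.1).det

/-- `x 0, …, x K` are the random points produced by `K` iterations of the randomized coordinate
descent method with volume sampling from the deterministic point `x₀`: at every iteration a fresh
subset of coordinates is drawn, independently of the others, by volume sampling. -/
structure IsRCDVS {Ω : Type*} [MeasurableSpace Ω] (P : Measure Ω) {n : ℕ}
    (f : EuclideanSpace ℝ (Fin n) → ℝ) (B : Matrix (Fin n) (Fin n) ℝ) (τ : ℕ)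
    (x₀ : EuclideanSpace ℝ (Fin n)) (K : ℕ) (S : Fin K → Ω → TauSubset n τ)
    (x : Fin (K + 1) → Ω → EuclideanSpace ℝ (Fin n)) : Prop where
  sample : ∀ k, IsVolumeSample P B τ (S k)
  indep : iIndepFun S P
  start : ∀ ω, x 0 ω = x₀
  step : ∀ (k : Fin K) (ω : Ω), x k.succ ω = coordStep f B (S k ω).1 (x k.castSucc ω)

/-! ### The coordinate approximation of a symmetric matrix -/

/-- For a spectral decomposition `Q diag(lam) Qᵀ` with `lam` in decreasing order (indices start at
`0`, so `lam ⟨i, _⟩` is the eigenvalue number `i + 1`), the matrix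
`Q diag(λ₁, …, λ_τ, λ_τ, …, λ_τ) Qᵀ + (∑_{i = τ + 1}^n λ_i) I`. -/
def tauApproxOf {n : ℕ} (Q : Matrix (Fin n) (Fin n) ℝ) (lam : Fin n → ℝ) (τ : ℕ) :
    Matrix (Fin n) (Fin n) ℝ :=
  Q * Matrix.diagonal
      (fun i : Fin n => lam ⟨min i.val (τ - 1), lt_of_le_of_lt (min_le_left _ _) i.isLt⟩) * Qᵀ
    + (∑ i : Fin n with τ ≤ i.val, lam i) • (1 : Matrix (Fin n) (Fin n) ℝ)

/-- The eigenvalues `λ₁ ≥ … ≥ λ_n` of a symmetric matrix, in decreasing order. -/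
def sortedEigenvalues {n : ℕ} {B : Matrix (Fin n) (Fin n) ℝ} (hB : B.IsHermitian) (i : Fin n) : ℝ :=
  hB.eigenvalues₀ (Fin.cast (Fintype.card_fin n).symm i)

/-- An orthogonal matrix whose columns are eigenvectors of a symmetric matrix, ordered as
`sortedEigenvalues`. -/
def sortedEigenvectors {n : ℕ} {B : Matrix (Fin n) (Fin n) ℝ} (hB : B.IsHermitian) :
    Matrix (Fin n) (Fin n) ℝ :=
  (hB.eigenvectorUnitary : Matrix (Fin n) (Fin n) ℝ).submatrix id
    ((finCongr (Fintype.card_fin n).symm).trans (Fintype.equivOfCardEq (Fintype.card_fin _)))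

theorem sortedEigenvalues_antitone {n : ℕ} {B : Matrix (Fin n) (Fin n) ℝ} (hB : B.IsHermitian) :
    Antitone (sortedEigenvalues hB) :=
  fun _ _ hij => hB.eigenvalues₀_antitone hij

theorem sortedEigenvectors_mul_transpose {n : ℕ} {B : Matrix (Fin n) (Fin n) ℝ}
    (hB : B.IsHermitian) : sortedEigenvectors hB * (sortedEigenvectors hB)ᵀ = 1 := by
  have h := Unitary.coe_mul_star_self hB.eigenvectorUnitary
  rw [sortedEigenvectors, Matrix.transpose_submatrix, Matrix.submatrix_mul_equiv]
  simpa [Matrix.star_eq_conjTranspose] using h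

/-- `B = Q diag(λ₁, …, λ_n) Qᵀ`, a spectral decomposition with decreasing eigenvalues. -/
theorem sorted_spectral_decomposition {n : ℕ} {B : Matrix (Fin n) (Fin n) ℝ}
    (hB : B.IsHermitian) :
    B = sortedEigenvectors hB * Matrix.diagonal (sortedEigenvalues hB)
      * (sortedEigenvectors hB)ᵀ := by
  have h := hB.spectral_theorem
  rw [Unitary.conjStarAlgAut_apply] at h
  set e : Fin n ≃ Fin n :=
    (finCongr (Fintype.card_fin n).symm).trans (Fintype.equivOfCardEq (Fintype.card_fin _)) with he
  have hd : Matrix.diagonal (sortedEigenvalues hB)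
      = (Matrix.diagonal hB.eigenvalues).submatrix e e := by
    rw [Matrix.submatrix_diagonal_equiv]
    congr 1
    funext i
    simp [sortedEigenvalues, Matrix.IsHermitian.eigenvalues, he]
  rw [sortedEigenvectors, hd, ← he, Matrix.transpose_submatrix, Matrix.submatrix_mul_equiv,
    Matrix.submatrix_mul_equiv]
  simpa [Matrix.star_eq_conjTranspose, Function.comp_def] using h

/-- The `τ`-coordinate approximation `B_τ` of a symmetric matrix `B`. -/
def tauApprox {n : ℕ} {B : Matrix (Fin n) (Fin n) ℝ} (hB : B.IsHermitian) (τ : ℕ) :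
    Matrix (Fin n) (Fin n) ℝ :=
  tauApproxOf (sortedEigenvectors hB) (sortedEigenvalues hB) τ

/-! ### The radius of a sublevel set -/

/-- `min_{z ∈ Argmin f} ‖x - z‖_M` (an infimum; meaningful when it is attained). -/
def distToArgmin {n : ℕ} (f : EuclideanSpace ℝ (Fin n) → ℝ) (M : Matrix (Fin n) (Fin n) ℝ)
    (x : EuclideanSpace ℝ (Fin n)) : ℝ :=
  sInf ((fun z => matSeminorm M (x - z)) '' argminSet f)

/-- `max_{x ∈ L_f(x₀)} min_{z ∈ Argmin f} ‖x - z‖_M` (a supremum of infima; meaningful when they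
are attained). -/
def sublevelRadius {n : ℕ} (f : EuclideanSpace ℝ (Fin n) → ℝ) (M : Matrix (Fin n) (Fin n) ℝ)
    (x₀ : EuclideanSpace ℝ (Fin n)) : ℝ :=
  sSup (distToArgmin f M '' sublevelSet f x₀)

end

/-! The heart is a bound on volume sampling. Write Z for the sum of the principal minors of B of
order τ, and g for a gradient. For all h, (g·h)² ≤ E[g_Sᵀ B_SS⁻¹ g_S] · ⟨B_τ h, h⟩. The expectation
is handled through rank-one updates: by the matrix determinant lemma, Z · E[g_Sᵀ B_SS⁻¹ g_S] is the
growth of the minor sum when g gᵀ is added to B (`det_principalSubmatrix_add_vecMulVec`). The minor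
sum is a coefficient of det(1 + X M), so it is invariant under orthogonal conjugation and B may be
taken diagonal. There the bound follows by Cauchy–Schwarz from an exchange inequality for elementary
symmetric sums (`sumMinors_diagonal_le_tauEigenvalue`). With h = x - z, z a minimizer nearest to x,
convexity and the descent inequality `IsOneSmooth.coordStep_le` give (f x - min f)² ≤ 2D² (f x - E
f(x⁺)). Independence lets this be averaged along the iterates, and the scalar recursion a_k² ≤ C
(a_k - a_{k+1}) yields a_k ≤ C/(k+1) with C = 2D². -/

/-! ### Orthogonal invariance of sums of principal minors. -/

/-- The sum of the principal minors of order `τ`. -/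
def sumMinors {n : ℕ} (M : Matrix (Fin n) (Fin n) ℝ) (τ : ℕ) : ℝ :=
  ∑ T : TauSubset n τ, (principalSubmatrix M T.1).det

theorem sum_tauSubset {n τ : ℕ} (F : Finset (Fin n) → ℝ) :
    ∑ T : TauSubset n τ, F T.1 = ∑ T ∈ Finset.univ.powersetCard τ, F T :=
  (Finset.sum_subtype _ (fun T => by simp [Finset.mem_powersetCard]) F).symm

theorem sumMinors_eq_coeff {n : ℕ} (M : Matrix (Fin n) (Fin n) ℝ) (τ : ℕ) :
    sumMinors M τ =
      (det (1 + (Polynomial.X : Polynomial ℝ) • M.map Polynomial.C)).coeff τ := by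
  rw [coeff_det_one_add_X_smul_eq_sum_minors]
  exact sum_tauSubset (fun T => (principalSubmatrix M T).det)

/-- The sum is a coefficient of det(1 + X M), and det(1 + UV) = det(1 + VU) brings Qᵀ next to Q. -/
theorem sumMinors_conj {n : ℕ} {Q : Matrix (Fin n) (Fin n) ℝ} (hQ : Q * Qᵀ = 1)
    (M : Matrix (Fin n) (Fin n) ℝ) (τ : ℕ) :
    sumMinors (Q * M * Qᵀ) τ = sumMinors M τ := by
  rw [sumMinors_eq_coeff, sumMinors_eq_coeff]
  congr 1
  have hQ' : Qᵀ.map (Polynomial.C (R := ℝ)) * Q.map Polynomial.C = 1 := by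
    rw [← Matrix.map_mul, mul_eq_one_comm.mp hQ]
    simp
  rw [Matrix.map_mul, Matrix.map_mul, Matrix.mul_assoc, ← Matrix.mul_smul, ← Matrix.smul_mul,
    ← Matrix.mul_assoc]
  rw [Matrix.mul_assoc, Matrix.det_one_add_mul_comm, Matrix.mul_assoc, hQ', Matrix.mul_one]

/-! ### Rank-one updates of determinants and of minor sums. -/

theorem det_add_vecMulVec_of_isUnit {m : Type*} [Fintype m] [DecidableEq m] (A : Matrix m m ℝ)
    (hA : IsUnit A.det) (u : m → ℝ) :
    (A + vecMulVec u u).det = A.det * (1 + u ⬝ᵥ (A⁻¹ *ᵥ u)) := by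
  rw [vecMulVec_eq Unit, det_add_replicateCol_mul_replicateRow hA,
    det_unique (n := Unit)]
  congr 1
  rw [Matrix.add_apply, Matrix.one_apply_eq, Matrix.mul_assoc, ← replicateCol_mulVec,
    replicateRow_mul_replicateCol_apply]

/-- For positive entries this is the matrix determinant lemma with the division cleared. Zero
entries, needed for singular B, come from shifting by ε and letting ε → 0⁺, both sides being
continuous in ε. -/
theorem det_diagonal_add_vecMulVec {m : Type*} [Fintype m] [DecidableEq m] {d : m → ℝ}
    (hd : ∀ i, 0 ≤ d i) (u : m → ℝ) :
    (diagonal d + vecMulVec u u).det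
      = ∏ i, d i + ∑ i, u i ^ 2 * ∏ j ∈ Finset.univ.erase i, d j := by
  have key : ∀ ε : ℝ, 0 < ε → (diagonal (fun i => d i + ε) + vecMulVec u u).det
      = ∏ i, (d i + ε) + ∑ i, u i ^ 2 * ∏ j ∈ Finset.univ.erase i, (d j + ε) := by
    intro ε hε
    have hne : ∀ i, d i + ε ≠ 0 := fun i => (add_pos_of_nonneg_of_pos (hd i) hε).ne'
    have hprod : ∏ i, (d i + ε) ≠ 0 := Finset.prod_ne_zero_iff.mpr fun i _ => hne i
    have hdet : IsUnit (diagonal (fun i => d i + ε)).det := by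
      rw [det_diagonal]; exact hprod.isUnit
    have hinv : (diagonal (fun i => d i + ε))⁻¹ = diagonal (fun i => (d i + ε)⁻¹) := by
      apply inv_eq_right_inv
      rw [diagonal_mul_diagonal, ← diagonal_one]
      congr 1
      funext i
      exact mul_inv_cancel₀ (hne i)
    rw [det_add_vecMulVec_of_isUnit _ hdet, hinv, det_diagonal, mul_add, mul_one]
    congr 1
    rw [dotProduct, Finset.mul_sum]
    refine Finset.sum_congr rfl fun i _ => ?_
    rw [mulVec_diagonal, ← Finset.mul_prod_erase _ _ (Finset.mem_univ i)]
    field_simp [hne i]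
  have hc : Continuous fun ε : ℝ => (diagonal (fun i => d i + ε) + vecMulVec u u).det := by
    apply Continuous.matrix_det
    have : Continuous fun ε : ℝ => fun i => d i + ε := by fun_prop
    exact this.matrix_diagonal.add continuous_const
  have hc' : Continuous fun ε : ℝ =>
      ∏ i, (d i + ε) + ∑ i, u i ^ 2 * ∏ j ∈ Finset.univ.erase i, (d j + ε) := by fun_prop
  have h1 := (hc.tendsto 0).mono_left (nhdsWithin_le_nhds (s := Set.Ioi 0))
  have h2 := (hc'.tendsto 0).mono_left (nhdsWithin_le_nhds (s := Set.Ioi 0))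
  have h3 := tendsto_nhds_unique (h1.congr' (by
    filter_upwards [self_mem_nhdsWithin] with ε hε using key ε hε)) h2
  simpa using h3

/-- `∑ ∏_{j ∈ S \ i} lam j` over the `τ`-element sets `S` that contain `i`. -/
def elemSymmAt {n : ℕ} (lam : Fin n → ℝ) (τ : ℕ) (i : Fin n) : ℝ :=
  ∑ S ∈ (Finset.univ.powersetCard τ).filter (i ∈ ·), ∏ j ∈ S.erase i, lam j

theorem elemSymmAt_nonneg {n : ℕ} {lam : Fin n → ℝ} (hlam : ∀ i, 0 ≤ lam i) (τ : ℕ) (i : Fin n) :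
    0 ≤ elemSymmAt lam τ i :=
  Finset.sum_nonneg fun _ _ => Finset.prod_nonneg fun _ _ => hlam _

theorem sumMinors_diagonal {n : ℕ} (lam : Fin n → ℝ) (τ : ℕ) :
    sumMinors (diagonal lam) τ = ∑ S ∈ Finset.univ.powersetCard τ, ∏ j ∈ S, lam j := by
  rw [sumMinors, ← sum_tauSubset (fun S => ∏ j ∈ S, lam j)]
  refine Finset.sum_congr rfl fun T _ => ?_
  rw [principalSubmatrix, submatrix_diagonal _ _ Subtype.val_injective, det_diagonal]
  exact Finset.prod_coe_sort T.1 lam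

theorem sumMinors_diagonal_add_vecMulVec {n : ℕ} {lam : Fin n → ℝ} (hlam : ∀ i, 0 ≤ lam i)
    (u : Fin n → ℝ) (τ : ℕ) :
    sumMinors (diagonal lam + vecMulVec u u) τ
      = sumMinors (diagonal lam) τ + ∑ i, u i ^ 2 * elemSymmAt lam τ i := by
  have h : ∑ i, u i ^ 2 * elemSymmAt lam τ i
      = ∑ S ∈ Finset.univ.powersetCard τ, ∑ i ∈ S, u i ^ 2 * ∏ j ∈ S.erase i, lam j := by
    simp_rw [elemSymmAt, Finset.mul_sum]
    exact Finset.sum_comm' (by simp; tauto)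
  rw [h, sumMinors_diagonal, ← Finset.sum_add_distrib, ← sum_tauSubset (fun S => _ + _), sumMinors]
  refine Finset.sum_congr rfl fun T _ => ?_
  have hsub : principalSubmatrix (diagonal lam + vecMulVec u u) T.1
      = diagonal (fun i : T.1 => lam i) + vecMulVec (fun i : T.1 => u i) (fun i : T.1 => u i) := by
    have hd := submatrix_diagonal lam (fun i : T.1 => (i : Fin n)) Subtype.val_injective
    rw [principalSubmatrix, submatrix_add]
    exact congrArg₂ (· + ·) hd rfl
  rw [hsub, det_diagonal_add_vecMulVec fun i => hlam _]
  congr 1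
  · exact Finset.prod_coe_sort T.1 lam
  · rw [← Finset.sum_coe_sort T.1]
    refine Finset.sum_congr rfl fun i _ => ?_
    congr 1
    refine Finset.prod_bij (fun j _ => (j : Fin n)) ?_ ?_ ?_ ?_
    · intro j hj
      simp only [Finset.mem_erase, Finset.mem_univ, and_true] at hj
      exact Finset.mem_erase.mpr ⟨fun h => hj (Subtype.ext h), j.2⟩
    · exact fun a _ b _ h => Subtype.ext h
    · intro j hj
      obtain ⟨h1, h2⟩ := Finset.mem_erase.mp hj
      exact ⟨⟨j, h2⟩, by simp [Subtype.ext_iff, h1], rfl⟩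
    · exact fun _ _ => rfl

/-! ### The exchange inequality and the eigenvalues of the coordinate approximation. -/

/-- Sets containing i contribute exactly the `lam i` term. A τ-set S avoiding i is too large to fit
in T, so it has some j outside T; replacing j by i is injective for fixed j and turns the product
over S \ j into a term of `elemSymmAt lam τ i`. -/
theorem sumMinors_diagonal_le {n : ℕ} {lam : Fin n → ℝ} (hlam : ∀ i, 0 ≤ lam i) {τ : ℕ}
    (i : Fin n) (T : Finset (Fin n)) (hT : T.card < τ) :
    sumMinors (diagonal lam) τ
      ≤ (lam i + ∑ j ∈ (Finset.univ \ T).erase i, lam j) * elemSymmAt lam τ i := by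
  rw [sumMinors_diagonal, ← Finset.sum_filter_add_sum_filter_not _ (i ∈ ·), add_mul]
  refine add_le_add (le_of_eq ?_) ?_
  · rw [elemSymmAt, Finset.mul_sum]
    refine Finset.sum_congr rfl fun S hS => ?_
    rw [Finset.mul_prod_erase _ _ (Finset.mem_filter.mp hS).2]
  have h1 : ∀ S ∈ (Finset.univ.powersetCard τ).filter (i ∉ ·),
      ∏ j ∈ S, lam j ≤ ∑ j ∈ S \ T, lam j * ∏ k ∈ S.erase j, lam k := by
    intro S hS
    have hc : S.card = τ := (Finset.mem_powersetCard.mp (Finset.mem_filter.mp hS).1).2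
    obtain ⟨j, hjS, hjT⟩ := Finset.exists_mem_notMem_of_card_lt_card (hT.trans_eq hc.symm)
    rw [← Finset.mul_prod_erase _ _ hjS]
    exact Finset.single_le_sum (f := fun j => lam j * ∏ k ∈ S.erase j, lam k)
      (fun k _ => mul_nonneg (hlam k) (Finset.prod_nonneg fun _ _ => hlam _))
      (Finset.mem_sdiff.mpr ⟨hjS, hjT⟩)
  refine (Finset.sum_le_sum h1).trans ?_
  rw [Finset.sum_comm' (s' := fun j => (Finset.univ.powersetCard τ).filter
    (fun S => i ∉ S ∧ j ∈ S)) (t' := (Finset.univ \ T).erase i), Finset.sum_mul]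
  · refine Finset.sum_le_sum fun j hj => ?_
    have hji : j ≠ i := Finset.ne_of_mem_erase hj
    rw [← Finset.mul_sum]
    refine mul_le_mul_of_nonneg_left ?_ (hlam j)
    have hinj : Set.InjOn (fun S : Finset (Fin n) => insert i (S.erase j))
        ((Finset.univ.powersetCard τ).filter (fun S => i ∉ S ∧ j ∈ S) : Finset (Finset (Fin n))) := by
      intro S hS S' hS' h
      simp only [Finset.coe_filter, Set.mem_ofPred_eq] at hS hS'
      -- The exchange is undone by erasing i and putting j back.
      have h' := congrArg (fun U : Finset (Fin n) => insert j (U.erase i)) h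
      simpa [Finset.erase_insert, hS.2.1, hS'.2.1, Finset.insert_erase, hS.2.2, hS'.2.2] using h'
    calc ∑ S ∈ (Finset.univ.powersetCard τ).filter (fun S => i ∉ S ∧ j ∈ S), ∏ k ∈ S.erase j, lam k
        = ∑ S ∈ ((Finset.univ.powersetCard τ).filter (fun S => i ∉ S ∧ j ∈ S)).image
            (fun S => insert i (S.erase j)), ∏ k ∈ S.erase i, lam k := by
          rw [Finset.sum_image hinj]
          refine Finset.sum_congr rfl fun S hS => ?_
          have := (Finset.mem_filter.mp hS).2.1
          rw [Finset.erase_insert (by simp [this])]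
      _ ≤ elemSymmAt lam τ i := by
          refine Finset.sum_le_sum_of_subset_of_nonneg ?_
            fun _ _ _ => Finset.prod_nonneg fun _ _ => hlam _
          intro U hU
          obtain ⟨S, hS, rfl⟩ := Finset.mem_image.mp hU
          obtain ⟨hc, hi, hjS⟩ := Finset.mem_filter.mp hS
          have hc := (Finset.mem_powersetCard.mp hc).2
          have hpos : 0 < S.card := Finset.card_pos.mpr ⟨j, hjS⟩
          simp only [Finset.mem_filter, Finset.mem_powersetCard, Finset.subset_univ, true_and,
            Finset.mem_insert_self, and_true]
          rw [Finset.card_insert_of_notMem (by simp [hi]), Finset.card_erase_of_mem hjS]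
          omega
  · intro S j
    simp only [Finset.mem_filter, Finset.mem_powersetCard, Finset.subset_univ, true_and,
      Finset.mem_sdiff, Finset.mem_erase, Finset.mem_univ]
    constructor
    · rintro ⟨⟨h1, h2⟩, h3, h4⟩
      exact ⟨⟨h1, h2, h3⟩, fun h => h2 (h ▸ h3), h4⟩
    · rintro ⟨⟨h1, h2, h3⟩, _, h4⟩
      exact ⟨⟨h1, h2⟩, h3, h4⟩

theorem card_filter_val_lt_le (n m : ℕ) : ((Finset.univ : Finset (Fin n)).filter (·.val < m)).card ≤ m := by
  rw [Fin.card_filter_val_lt]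
  exact min_le_right _ _

/-- The eigenvalues of the `τ`-coordinate approximation. -/
def tauEigenvalue {n : ℕ} (lam : Fin n → ℝ) (τ : ℕ) (i : Fin n) : ℝ :=
  lam ⟨min i.val (τ - 1), lt_of_le_of_lt (min_le_left _ _) i.isLt⟩
    + ∑ j : Fin n with τ ≤ j.val, lam j

theorem sumMinors_diagonal_le_tauEigenvalue {n : ℕ} {lam : Fin n → ℝ} (hlam : ∀ i, 0 ≤ lam i)
    {τ : ℕ} (hτ : 1 ≤ τ) (i : Fin n) :
    sumMinors (diagonal lam) τ ≤ tauEigenvalue lam τ i * elemSymmAt lam τ i := by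
  rcases lt_or_ge i.val τ with hi | hi
  · have hmem : i ∈ (Finset.univ : Finset (Fin n)).filter (·.val < τ) := by simp [hi]
    -- T is the first τ indices without i: outside T and i only the tail sum remains.
    convert! sumMinors_diagonal_le hlam i
      (((Finset.univ : Finset (Fin n)).filter (·.val < τ)).erase i) ?_ using 2
    · rw [tauEigenvalue]
      congr 1
      · congr 1
        ext
        simp; omega
      · refine Finset.sum_congr ?_ fun _ _ => rfl
        ext j
        have : j = i ↔ j.val = i.val := Fin.ext_iff
        simp; grind
    · rw [Finset.card_erase_of_mem hmem]
      have := card_filter_val_lt_le n τ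
      omega
  · have hlt : τ - 1 < n := by omega
    -- T is the first τ - 1 indices. Now i lies in the complement, whose full sum is the τ-th
    -- eigenvalue (index τ - 1) plus the tail.
    convert! sumMinors_diagonal_le hlam i
      ((Finset.univ : Finset (Fin n)).filter (·.val < τ - 1)) ?_ using 2
    · rw [tauEigenvalue, Finset.add_sum_erase _ _ (by simp; omega)]
      have hset : Finset.univ \ ((Finset.univ : Finset (Fin n)).filter (·.val < τ - 1))
          = insert ⟨τ - 1, hlt⟩ ((Finset.univ : Finset (Fin n)).filter (τ ≤ ·.val)) := by
        ext j
        have : j = ⟨τ - 1, hlt⟩ ↔ j.val = τ - 1 := Fin.ext_iff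
        simp [this]; omega
      rw [hset, Finset.sum_insert (by simp; omega)]
      congr 2
      ext
      simp; omega
    · have := card_filter_val_lt_le n (τ - 1)
      omega

/-! ### The matrix inequality for volume sampling. -/

theorem tauApproxOf_eq {n : ℕ} {Q : Matrix (Fin n) (Fin n) ℝ} (hQ : Q * Qᵀ = 1) (lam : Fin n → ℝ)
    (τ : ℕ) : tauApproxOf Q lam τ = Q * diagonal (tauEigenvalue lam τ) * Qᵀ := by
  have : diagonal (tauEigenvalue lam τ) = diagonal
      (fun i : Fin n => lam ⟨min i.val (τ - 1), lt_of_le_of_lt (min_le_left _ _) i.isLt⟩)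
      + (∑ j : Fin n with τ ≤ j.val, lam j) • (1 : Matrix (Fin n) (Fin n) ℝ) := by
    rw [← diagonal_one, ← diagonal_smul, diagonal_add]
    congr 1
    funext i
    simp [tauEigenvalue]
  rw [this, Matrix.mul_add, Matrix.add_mul, Matrix.mul_smul, Matrix.mul_one, Matrix.smul_mul, hQ]
  rfl

theorem dotProduct_conj_diagonal {n : ℕ} (Q : Matrix (Fin n) (Fin n) ℝ) (d h : Fin n → ℝ) :
    ((Q * diagonal d * Qᵀ) *ᵥ h) ⬝ᵥ h = ∑ i, d i * (Qᵀ *ᵥ h) i ^ 2 := by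
  rw [← mulVec_mulVec, ← mulVec_mulVec, dotProduct_comm, dotProduct_mulVec, ← mulVec_transpose,
    dotProduct]
  refine Finset.sum_congr rfl fun i _ => ?_
  rw [mulVec_diagonal]
  ring

/-- The inequality `B_τ⁻¹ ⪯ E[I_S B_{SS}⁻¹ I_Sᵀ]` in variational form, with rank one updates. -/
theorem sumMinors_mul_sq_dotProduct_le {n : ℕ} {Q : Matrix (Fin n) (Fin n) ℝ} (hQ : Q * Qᵀ = 1)
    {lam : Fin n → ℝ} (hlam : ∀ i, 0 ≤ lam i) {τ : ℕ} (hτ : 1 ≤ τ) (g h : Fin n → ℝ) :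
    sumMinors (Q * diagonal lam * Qᵀ) τ * (g ⬝ᵥ h) ^ 2 ≤
      (sumMinors (Q * diagonal lam * Qᵀ + vecMulVec g g) τ - sumMinors (Q * diagonal lam * Qᵀ) τ) *
        ((tauApproxOf Q lam τ *ᵥ h) ⬝ᵥ h) := by
  set u := Qᵀ *ᵥ g with hu
  have hg : g = Q *ᵥ u := by rw [hu, mulVec_mulVec, hQ, one_mulVec]
  have hgg : Q * diagonal lam * Qᵀ + vecMulVec g g = Q * (diagonal lam + vecMulVec u u) * Qᵀ := by
    rw [Matrix.mul_add, Matrix.add_mul, mul_vecMulVec, vecMulVec_mul, vecMul_transpose, ← hg]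
  have hgh : g ⬝ᵥ h = ∑ i, u i * (Qᵀ *ᵥ h) i := by
    conv_lhs => rw [hg, dotProduct_comm, dotProduct_mulVec, ← mulVec_transpose, dotProduct_comm]
    rfl
  have hZ : 0 ≤ sumMinors (diagonal lam) τ := by
    rw [sumMinors_diagonal]
    exact Finset.sum_nonneg fun _ _ => Finset.prod_nonneg fun _ _ => hlam _
  have hβ : ∀ i, 0 ≤ tauEigenvalue lam τ i := fun i =>
    add_nonneg (hlam _) (Finset.sum_nonneg fun _ _ => hlam _)
  rw [hgg, sumMinors_conj hQ, sumMinors_conj hQ, sumMinors_diagonal_add_vecMulVec hlam,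
    add_sub_cancel_left, tauApproxOf_eq hQ, dotProduct_conj_diagonal, hgh,
    ← Real.sq_sqrt hZ, ← mul_pow, Finset.mul_sum]
  -- Cauchy–Schwarz needs only a termwise bound once √Z is absorbed into the squared sum; that bound
  -- is the eigenvalue inequality times a square.
  refine Finset.sum_sq_le_sum_mul_sum_of_sq_le_mul _
    (fun i _ => mul_nonneg (sq_nonneg _) (elemSymmAt_nonneg hlam τ i))
    (fun i _ => mul_nonneg (hβ i) (sq_nonneg _)) fun i _ => ?_
  have := mul_le_mul_of_nonneg_right (sumMinors_diagonal_le_tauEigenvalue hlam hτ i)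
    (sq_nonneg (u i * (Qᵀ *ᵥ h) i))
  rw [mul_pow, Real.sq_sqrt hZ]
  nlinarith [this]

/-! ### From minors back to principal submatrices, and properties of the seminorms. -/

theorem dotProduct_extendByZero {n : ℕ} (T : Finset (Fin n)) (a : Fin n → ℝ) (v : T → ℝ) :
    a ⬝ᵥ (extendByZero T v).ofLp = (fun i : T => a i) ⬝ᵥ v := by
  rw [dotProduct, dotProduct, ← Finset.sum_subset (Finset.subset_univ T)
    (fun i _ hi => by simp [extendByZero, hi]), ← Finset.sum_coe_sort]
  exact Finset.sum_congr rfl fun i _ => by simp [extendByZero]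

/-- A singular principal block causes no loss: a kernel vector of it, extended by zero, lies in the
kernel of B by semidefiniteness. It is then orthogonal to g, so the updated block is singular too
and both sides vanish. -/
theorem det_principalSubmatrix_add_vecMulVec {n : ℕ} {B : Matrix (Fin n) (Fin n) ℝ}
    (hB : B.PosSemidef) {g : Fin n → ℝ} (hg : ∀ v, B *ᵥ v = 0 → g ⬝ᵥ v = 0)
    (T : Finset (Fin n)) :
    (principalSubmatrix (B + vecMulVec g g) T).det - (principalSubmatrix B T).det =
      (principalSubmatrix B T).det *
        ((fun i : T => g i) ⬝ᵥ ((principalSubmatrix B T)⁻¹ *ᵥ fun i : T => g i)) := by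
  have hsub : principalSubmatrix (B + vecMulVec g g) T
      = principalSubmatrix B T + vecMulVec (fun i : T => g i) (fun i : T => g i) := rfl
  rw [hsub]
  by_cases hdet : (principalSubmatrix B T).det = 0
  · rw [hdet, zero_mul, sub_zero]
    obtain ⟨v, hv0, hv⟩ := exists_mulVec_eq_zero_iff.mpr hdet
    refine exists_mulVec_eq_zero_iff.mp ⟨v, hv0, ?_⟩
    set w : Fin n → ℝ := (extendByZero T v).ofLp with hw
    have hsum := fun a : Fin n → ℝ => dotProduct_extendByZero T a v
    have hBw : B *ᵥ w = 0 := by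
      rw [← hB.dotProduct_mulVec_zero_iff, star_trivial, dotProduct_comm, hsum]
      have : (fun i : T => (B *ᵥ w) i) = 0 := by
        rw [← hv]
        funext i
        exact hsum (B i)
      rw [this, zero_dotProduct]
    rw [add_mulVec, hv, vecMulVec_mulVec, ← hsum g, hg w hBw]
    simp
  · rw [det_add_vecMulVec_of_isUnit _ (Ne.isUnit hdet)]
    ring

theorem sortedEigenvalues_nonneg {n : ℕ} {B : Matrix (Fin n) (Fin n) ℝ} (hB : B.PosSemidef)
    (i : Fin n) : 0 ≤ sortedEigenvalues hB.isHermitian i := by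
  have h := hB.eigenvalues_nonneg
    ((finCongr (Fintype.card_fin n).symm).trans (Fintype.equivOfCardEq (Fintype.card_fin _)) i)
  simpa [sortedEigenvalues, Matrix.IsHermitian.eigenvalues] using h

theorem inner_eq_dotProduct {n : ℕ} (x y : EuclideanSpace ℝ (Fin n)) :
    inner ℝ x y = x.ofLp ⬝ᵥ y.ofLp := by
  rw [EuclideanSpace.inner_eq_star_dotProduct, star_trivial, dotProduct_comm]

theorem matSeminorm_sq {n : ℕ} {M : Matrix (Fin n) (Fin n) ℝ} (hM : M.PosSemidef)
    (v : EuclideanSpace ℝ (Fin n)) : matSeminorm M v ^ 2 = (M *ᵥ v.ofLp) ⬝ᵥ v.ofLp := by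
  rw [matSeminorm, Real.sq_sqrt]
  have := hM.dotProduct_mulVec_nonneg v.ofLp
  rwa [star_trivial, dotProduct_comm] at this

theorem continuous_matSeminorm {n : ℕ} (M : Matrix (Fin n) (Fin n) ℝ) :
    Continuous (matSeminorm M) := by
  unfold matSeminorm
  fun_prop

theorem tauApprox_posSemidef {n : ℕ} {B : Matrix (Fin n) (Fin n) ℝ} (hB : B.PosSemidef) (τ : ℕ) :
    (tauApprox hB.isHermitian τ).PosSemidef := by
  have hlam := sortedEigenvalues_nonneg hB
  rw [tauApprox, tauApproxOf_eq (sortedEigenvectors_mul_transpose _)]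
  have hd : (diagonal (tauEigenvalue (sortedEigenvalues hB.isHermitian) τ)).PosSemidef :=
    PosSemidef.diagonal fun i => add_nonneg (hlam _) (Finset.sum_nonneg fun _ _ => hlam _)
  simpa using hd.mul_mul_conjTranspose_same (sortedEigenvectors hB.isHermitian)

theorem sumMinors_mul_sq_dotProduct_le_tauApprox {n : ℕ} {B : Matrix (Fin n) (Fin n) ℝ}
    (hB : B.PosSemidef) {τ : ℕ} (hτ : 1 ≤ τ) (g h : Fin n → ℝ) :
    sumMinors B τ * (g ⬝ᵥ h) ^ 2 ≤ (sumMinors (B + vecMulVec g g) τ - sumMinors B τ) *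
        ((tauApprox hB.isHermitian τ *ᵥ h) ⬝ᵥ h) := by
  have := sumMinors_mul_sq_dotProduct_le (sortedEigenvectors_mul_transpose hB.isHermitian)
    (sortedEigenvalues_nonneg hB) hτ g h
  rwa [← sorted_spectral_decomposition hB.isHermitian] at this

/-! ### One step of the method. -/

section Descent

variable {n : ℕ} {f : EuclideanSpace ℝ (Fin n) → ℝ} {B : Matrix (Fin n) (Fin n) ℝ}

theorem ConvexOn.add_inner_gradient_le (hconv : ConvexOn ℝ Set.univ f) (hf : Differentiable ℝ f)
    (x y : EuclideanSpace ℝ (Fin n)) : f x + inner ℝ (gradient f x) (y - x) ≤ f y := by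
  have hg := (hf x).hasGradientAt.hasFDerivAt
  have hline : HasDerivAt (fun t : ℝ => AffineMap.lineMap x y t) (y - x) 0 :=
    AffineMap.hasDerivAt_lineMap
  have hd : HasDerivAt (f ∘ AffineMap.lineMap (k := ℝ) x y) (inner ℝ (gradient f x) (y - x)) 0 := by
    have h0 : AffineMap.lineMap (k := ℝ) x y 0 = x := AffineMap.lineMap_apply_zero x y
    rw [← h0] at hg
    have := hg.comp_hasDerivAt (0 : ℝ) hline
    simpa using this
  have hc : ConvexOn ℝ Set.univ (f ∘ AffineMap.lineMap (k := ℝ) x y) := by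
    simpa using hconv.comp_affineMap (AffineMap.lineMap (k := ℝ) x y)
  have := hc.le_slope_of_hasDerivAt (Set.mem_univ 0) (Set.mem_univ 1) one_pos hd
  simp only [slope, Function.comp_apply, AffineMap.lineMap_apply_one, AffineMap.lineMap_apply_zero,
    sub_zero, inv_one, one_smul, vsub_eq_sub] at this
  linarith

/-- A function bounded below has gradients orthogonal to the kernel of its smoothness matrix. -/
theorem IsOneSmooth.gradient_dotProduct_eq_zero (hf : IsOneSmooth f B) (hB : B.PosSemidef)
    {z : EuclideanSpace ℝ (Fin n)} (hz : z ∈ argminSet f) (x : EuclideanSpace ℝ (Fin n))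
    (v : Fin n → ℝ) (hv : B *ᵥ v = 0) : (gradient f x).ofLp ⬝ᵥ v = 0 := by
  have key : ∀ t : ℝ, f z ≤ f x + t * ((gradient f x).ofLp ⬝ᵥ v) := by
    intro t
    have h := (hz _).trans (hf.upper_bound x (x + t • WithLp.toLp 2 v))
    rw [add_sub_cancel_left, matSeminorm_sq hB, inner_eq_dotProduct] at h
    simpa [mulVec_smul, hv] using h
  by_contra hne
  -- This t makes the right-hand side of `key` equal to f z - 1.
  have h := key (-(f x - f z + 1) / ((gradient f x).ofLp ⬝ᵥ v))
  rw [div_mul_cancel₀ _ hne] at h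
  linarith

/-- For an invertible block, the step h = B_TT⁻¹ g_T makes the quadratic term of the smoothness
bound equal to g_Tᵀ B_TT⁻¹ g_T, half of which survives against the linear term. -/
theorem IsOneSmooth.coordStep_le (hf : IsOneSmooth f B) (hB : B.PosSemidef)
    (T : Finset (Fin n)) (x : EuclideanSpace ℝ (Fin n)) :
    f (coordStep f B T x) ≤ f x - 1 / 2 * (subvector T (gradient f x) ⬝ᵥ
      ((principalSubmatrix B T)⁻¹ *ᵥ subvector T (gradient f x))) := by
  set g := subvector T (gradient f x) with hg
  set A := principalSubmatrix B T with hA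
  by_cases hdet : IsUnit A.det
  · have h := hf.upper_bound x (coordStep f B T x)
    have hy : coordStep f B T x - x = - extendByZero T (A⁻¹ *ᵥ g) := by
      rw [coordStep]; abel
    have h1 : (gradient f x).ofLp ⬝ᵥ (extendByZero T (A⁻¹ *ᵥ g)).ofLp = g ⬝ᵥ (A⁻¹ *ᵥ g) :=
      dotProduct_extendByZero T _ _
    have h2 : (B *ᵥ (extendByZero T (A⁻¹ *ᵥ g)).ofLp) ⬝ᵥ (extendByZero T (A⁻¹ *ᵥ g)).ofLp
        = g ⬝ᵥ (A⁻¹ *ᵥ g) := by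
      rw [dotProduct_extendByZero]
      congr 1
      have : (fun i : T => (B *ᵥ (extendByZero T (A⁻¹ *ᵥ g)).ofLp) i) = A *ᵥ (A⁻¹ *ᵥ g) :=
        funext fun i => dotProduct_extendByZero T (B i) (A⁻¹ *ᵥ g)
      rw [this, mulVec_mulVec, mul_nonsing_inv _ hdet, one_mulVec]
    rw [hy, matSeminorm_sq hB, inner_neg_right, inner_eq_dotProduct, h1, WithLp.ofLp_neg,
      mulVec_neg, neg_dotProduct_neg, h2] at h
    linarith
  -- The inverse of a singular block is zero by convention, so the point does not move.
  · have hinv : A⁻¹ = 0 := nonsing_inv_apply_not_isUnit _ hdet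
    have hx : coordStep f B T x = x := by
      rw [coordStep, ← hA, hinv, zero_mulVec]
      ext i
      simp [extendByZero]
    rw [hx, hinv]
    simp

theorem IsOneSmooth.coordStep_le_self (hf : IsOneSmooth f B) (hB : B.PosSemidef)
    (T : Finset (Fin n)) (x : EuclideanSpace ℝ (Fin n)) : f (coordStep f B T x) ≤ f x := by
  have h := hf.coordStep_le hB T x
  have hinv : (principalSubmatrix B T)⁻¹.PosSemidef := (hB.submatrix _).inv
  have := hinv.dotProduct_mulVec_nonneg (subvector T (gradient f x))
  rw [star_trivial] at this
  linarith

/-- The expected decrease of one step of coordinate descent with volume sampling. -/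
theorem sq_sub_min_le_expected_decrease (hB : B.PosSemidef) (hconv : ConvexOn ℝ Set.univ f)
    (hf : IsOneSmooth f B) {τ : ℕ} (hτ : 1 ≤ τ) (hZ : 0 < sumMinors B τ)
    {z : EuclideanSpace ℝ (Fin n)} (hz : z ∈ argminSet f) (x : EuclideanSpace ℝ (Fin n)) :
    (f x - f z) ^ 2 ≤ 2 * matSeminorm (tauApprox hB.isHermitian τ) (x - z) ^ 2 *
      (f x - ∑ T : TauSubset n τ,
        (principalSubmatrix B T.1).det / sumMinors B τ * f (coordStep f B T.1 x)) := by
  set g := (gradient f x).ofLp with hg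
  have hone : ∑ T : TauSubset n τ, (principalSubmatrix B T.1).det / sumMinors B τ = 1 := by
    rw [← Finset.sum_div]
    exact div_self hZ.ne'
  have hdet : ∀ T : TauSubset n τ, 0 ≤ (principalSubmatrix B T.1).det := fun T =>
    (hB.submatrix _).det_nonneg
  -- Half the expected value of g_Sᵀ B_SS⁻¹ g_S bounds the expected decrease from below; that
  -- expectation is the relative growth of the minor sum.
  have hdec : (sumMinors (B + vecMulVec g g) τ - sumMinors B τ) / sumMinors B τ
      ≤ 2 * (f x - ∑ T : TauSubset n τ,
        (principalSubmatrix B T.1).det / sumMinors B τ * f (coordStep f B T.1 x)) := by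
    have h1 : f x - ∑ T : TauSubset n τ,
        (principalSubmatrix B T.1).det / sumMinors B τ * f (coordStep f B T.1 x)
        = ∑ T : TauSubset n τ, (principalSubmatrix B T.1).det / sumMinors B τ *
          (f x - f (coordStep f B T.1 x)) := by
      simp_rw [mul_sub, Finset.sum_sub_distrib, ← Finset.sum_mul, hone, one_mul]
    rw [h1, sumMinors, sumMinors, ← Finset.sum_sub_distrib, Finset.sum_div, Finset.mul_sum]
    refine Finset.sum_le_sum fun T _ => ?_
    rw [det_principalSubmatrix_add_vecMulVec hB (hf.gradient_dotProduct_eq_zero hB hz x)]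
    have h2 := hf.coordStep_le hB T.1 x
    have h3 := mul_le_mul_of_nonneg_left h2 (div_nonneg (hdet T) hZ.le)
    rw [mul_div_right_comm]
    change _ / sumMinors B τ * (subvector T.1 (gradient f x) ⬝ᵥ
      ((principalSubmatrix B T.1)⁻¹ *ᵥ subvector T.1 (gradient f x))) ≤ _ * (_ / sumMinors B τ * _)
    linarith
  have hgrad : f x - f z ≤ g ⬝ᵥ (x - z).ofLp := by
    have h := hconv.add_inner_gradient_le hf.differentiable x z
    rw [← neg_sub x z, inner_neg_right, inner_eq_dotProduct] at h
    linarith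
  have hmain := sumMinors_mul_sq_dotProduct_le_tauApprox hB hτ g (x - z).ofLp
  rw [← matSeminorm_sq (tauApprox_posSemidef hB τ)] at hmain
  calc (f x - f z) ^ 2 ≤ (g ⬝ᵥ (x - z).ofLp) ^ 2 :=
        pow_le_pow_left₀ (sub_nonneg.mpr (hz x)) hgrad 2
    _ ≤ (sumMinors (B + vecMulVec g g) τ - sumMinors B τ) / sumMinors B τ *
        matSeminorm (tauApprox hB.isHermitian τ) (x - z) ^ 2 := by
        rw [div_mul_eq_mul_div, le_div_iff₀ hZ]
        linarith
    _ ≤ _ := by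
        have := mul_le_mul_of_nonneg_right hdec
          (sq_nonneg (matSeminorm (tauApprox hB.isHermitian τ) (x - z)))
        linarith

/-! ### Attainment of the extrema, and the decrease in terms of the radius. -/

theorem isCompact_sublevelSet (hf : Continuous f) {x₀ : EuclideanSpace ℝ (Fin n)}
    (hbdd : Bornology.IsBounded (sublevelSet f x₀)) : IsCompact (sublevelSet f x₀) :=
  Metric.isCompact_of_isClosed_isBounded (isClosed_le hf continuous_const) hbdd

theorem argminSet_nonempty (hf : Continuous f) {x₀ : EuclideanSpace ℝ (Fin n)}
    (hbdd : Bornology.IsBounded (sublevelSet f x₀)) : (argminSet f).Nonempty := by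
  obtain ⟨z, hz, hmin⟩ := (isCompact_sublevelSet hf hbdd).exists_isMinOn
    ⟨x₀, le_refl (f x₀)⟩ hf.continuousOn
  refine ⟨z, fun y => ?_⟩
  by_cases hy : f y ≤ f x₀
  · exact hmin hy
  · exact le_trans hz (not_le.mp hy).le

theorem isCompact_argminSet (hf : Continuous f) {x₀ : EuclideanSpace ℝ (Fin n)}
    (hbdd : Bornology.IsBounded (sublevelSet f x₀)) : IsCompact (argminSet f) := by
  refine (isCompact_sublevelSet hf hbdd).of_isClosed_subset ?_ fun z hz => hz x₀
  have : argminSet f = ⋂ y, {z | f z ≤ f y} := by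
    ext; simp [argminSet]
  rw [this]
  exact isClosed_iInter fun y => isClosed_le hf continuous_const

theorem minValue_eq {z : EuclideanSpace ℝ (Fin n)} (hz : z ∈ argminSet f) : minValue f = f z :=
  IsLeast.csInf_eq ⟨⟨z, rfl⟩, by rintro _ ⟨y, rfl⟩; exact hz y⟩

theorem isLeast_minValue {z : EuclideanSpace ℝ (Fin n)} (hz : z ∈ argminSet f) :
    IsLeast (Set.range f) (minValue f) := by
  rw [minValue_eq hz]
  exact ⟨⟨z, rfl⟩, by rintro _ ⟨y, rfl⟩; exact hz y⟩

theorem isLeast_distToArgmin (hf : Continuous f) {x₀ : EuclideanSpace ℝ (Fin n)}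
    (hbdd : Bornology.IsBounded (sublevelSet f x₀)) (M : Matrix (Fin n) (Fin n) ℝ)
    (x : EuclideanSpace ℝ (Fin n)) :
    IsLeast ((fun z => matSeminorm M (x - z)) '' argminSet f) (distToArgmin f M x) := by
  have hc : Continuous fun z => matSeminorm M (x - z) :=
    (continuous_matSeminorm M).comp (continuous_const.sub continuous_id)
  exact ((isCompact_argminSet hf hbdd).image hc).isLeast_sInf
    ((argminSet_nonempty hf hbdd).image _)

theorem isGreatest_sublevelRadius (hf : Continuous f) {x₀ : EuclideanSpace ℝ (Fin n)}
    (hbdd : Bornology.IsBounded (sublevelSet f x₀)) (M : Matrix (Fin n) (Fin n) ℝ) :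
    IsGreatest (distToArgmin f M '' sublevelSet f x₀) (sublevelRadius f M x₀) := by
  have hc : Continuous (distToArgmin f M) := by
    refine (isCompact_argminSet hf hbdd).continuous_sInf
      (f := fun x z => matSeminorm M (x - z)) ?_
    exact (continuous_matSeminorm M).comp (continuous_fst.sub continuous_snd)
  exact ((isCompact_sublevelSet hf hbdd).image hc).isGreatest_sSup
    (Set.Nonempty.image _ ⟨x₀, le_refl (f x₀)⟩)

theorem sq_sub_minValue_le (hB : B.PosSemidef) (hconv : ConvexOn ℝ Set.univ f)
    (hf : IsOneSmooth f B) {x₀ : EuclideanSpace ℝ (Fin n)}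
    (hbdd : Bornology.IsBounded (sublevelSet f x₀)) {τ : ℕ} (hτ : 1 ≤ τ)
    (hZ : 0 < sumMinors B τ) {x : EuclideanSpace ℝ (Fin n)} (hx : x ∈ sublevelSet f x₀) :
    (f x - minValue f) ^ 2 ≤ 2 * sublevelRadius f (tauApprox hB.isHermitian τ) x₀ ^ 2 *
      (f x - ∑ T : TauSubset n τ,
        (principalSubmatrix B T.1).det / sumMinors B τ * f (coordStep f B T.1 x)) := by
  have hcont := hf.differentiable.continuous
  obtain ⟨z, hz, hzd⟩ := (isLeast_distToArgmin hcont hbdd (tauApprox hB.isHermitian τ) x).1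
  have hle : distToArgmin f (tauApprox hB.isHermitian τ) x
      ≤ sublevelRadius f (tauApprox hB.isHermitian τ) x₀ :=
    (isGreatest_sublevelRadius hcont hbdd _).2 ⟨x, hx, rfl⟩
  have h := sq_sub_min_le_expected_decrease hB hconv hf hτ hZ hz x
  rw [minValue_eq hz]
  refine h.trans ?_
  -- The distance may be enlarged to the radius only because the factor it multiplies is
  -- nonnegative.
  have hdec : ∑ T : TauSubset n τ,
      (principalSubmatrix B T.1).det / sumMinors B τ * f (coordStep f B T.1 x) ≤ f x := by
    have hone : ∑ T : TauSubset n τ, (principalSubmatrix B T.1).det / sumMinors B τ = 1 := by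
      rw [← Finset.sum_div]
      exact div_self hZ.ne'
    calc _ ≤ ∑ T : TauSubset n τ, (principalSubmatrix B T.1).det / sumMinors B τ * f x :=
          Finset.sum_le_sum fun T _ => mul_le_mul_of_nonneg_left (hf.coordStep_le_self hB T.1 x)
            (div_nonneg (hB.submatrix _).det_nonneg hZ.le)
      _ = f x := by rw [← Finset.sum_mul, hone, one_mul]
  refine mul_le_mul_of_nonneg_right ?_ (sub_nonneg.mpr hdec)
  have : matSeminorm (tauApprox hB.isHermitian τ) (x - z)
      ≤ sublevelRadius f (tauApprox hB.isHermitian τ) x₀ := hzd.trans_le hle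
  have h0 : 0 ≤ matSeminorm (tauApprox hB.isHermitian τ) (x - z) := Real.sqrt_nonneg _
  gcongr

end Descent

/-! ### The scalar recursion. -/

/-- Induction. If a_k ≤ C/(k+2), monotonicity suffices. Otherwise a_k > C/(k+2), so C a_{k+1} ≤ a_k
(C - a_k) ≤ a_k C (k+1)/(k+2), and the induction hypothesis bounds this by C²/(k+2). -/
theorem le_div_of_sq_le_mul_sub {N : ℕ} {C : ℝ} (a : Fin (N + 1) → ℝ) (hC : 0 ≤ C)
    (h0 : a 0 ≤ C) (hmono : ∀ k : Fin N, a k.succ ≤ a k.castSucc)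
    (hstep : ∀ k : Fin N, a k.castSucc ^ 2 ≤ C * (a k.castSucc - a k.succ))
    (k : Fin (N + 1)) : a k ≤ C / (((k : ℕ) : ℝ) + 1) := by
  induction k using Fin.induction with
  | zero => simpa using h0
  | succ k ih =>
    simp only [Fin.val_castSucc, Fin.val_succ, Nat.cast_add, Nat.cast_one] at ih ⊢
    set m : ℝ := ((k : ℕ) : ℝ) with hm
    have hm0 : 0 ≤ m := Nat.cast_nonneg _
    have h1 := hstep k
    have h2 := hmono k
    rw [le_div_iff₀ (by positivity)] at ih ⊢
    by_cases hsmall : a k.castSucc * (m + 1 + 1) ≤ C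
    · exact le_trans (mul_le_mul_of_nonneg_right h2 (by positivity)) hsmall
    · rw [not_le] at hsmall
      have hCpos : 0 < C := by
        rcases hC.eq_or_lt with h | h
        · rw [← h, zero_mul] at h1
          have : a k.castSucc = 0 := pow_eq_zero_iff two_ne_zero |>.mp (le_antisymm h1 (sq_nonneg _))
          rw [this] at hsmall
          linarith
        · exact h
      have hak : 0 < a k.castSucc := by
        by_contra hneg
        nlinarith
      have h3 : a k.castSucc * C ≤ a k.castSucc * (a k.castSucc * (m + 1 + 1)) :=
        mul_le_mul_of_nonneg_left hsmall.le hak.le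
      refine le_of_mul_le_mul_left ?_ hCpos
      nlinarith

/-! ### Measurability, independence and conditional averaging of the iterates. -/

section Iterates

variable {Ω : Type*} [MeasurableSpace Ω] {P : Measure Ω} {n : ℕ}
  {f : EuclideanSpace ℝ (Fin n) → ℝ} {B : Matrix (Fin n) (Fin n) ℝ} {τ : ℕ}
  {x₀ : EuclideanSpace ℝ (Fin n)} {K : ℕ} {S : Fin K → Ω → TauSubset n τ}
  {x : Fin (K + 1) → Ω → EuclideanSpace ℝ (Fin n)}

/-- If a volume sample exists then some principal minor of order `τ` is nonzero. -/
theorem IsVolumeSample.sumMinors_pos [IsProbabilityMeasure P] (hB : B.PosSemidef)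
    {T : Ω → TauSubset n τ} (hT : IsVolumeSample P B τ T) : 0 < sumMinors B τ := by
  have hnn : 0 ≤ sumMinors B τ :=
    Finset.sum_nonneg fun T _ => (hB.submatrix _).det_nonneg
  refine hnn.lt_of_ne fun h => ?_
  -- With a zero normalizer, division by zero gives every value of the sample probability 0,
  -- impossible under a probability measure.
  have hz : ∀ U, P (T ⁻¹' {U}) = 0 := by
    intro U
    have := hT.law U
    rw [← sumMinors, ← h, div_zero, measureReal_def, ENNReal.toReal_eq_zero_iff] at this
    exact this.resolve_right (measure_ne_top _ _)
  have : P Set.univ = 0 := by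
    have hu : (Set.univ : Set Ω) = ⋃ U, T ⁻¹' {U} := by ext; simp
    rw [hu]
    exact measure_iUnion_null hz
  simp at this

/-- Every iterate is a function of the previously drawn subsets. -/
theorem IsRCDVS.exists_eq_comp (h : IsRCDVS P f B τ x₀ K S x) (k : Fin (K + 1)) :
    ∃ G : ((Finset.univ.filter fun j : Fin K => j.val < k.val) → TauSubset n τ) →
      EuclideanSpace ℝ (Fin n), x k = fun ω => G fun j => S j ω := by
  induction k using Fin.induction with
  | zero => exact ⟨fun _ => x₀, funext h.start⟩
  | succ k ih =>
    obtain ⟨G, hG⟩ := ih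
    refine ⟨fun s => coordStep f B (s ⟨k, by simp⟩).1 (G fun j => s ⟨j, ?_⟩), ?_⟩
    · have := (Finset.mem_filter.mp j.2).2
      simp only [Fin.val_castSucc] at this
      simp; omega
    · funext ω
      rw [h.step, hG]

theorem IsRCDVS.mem_sublevelSet (h : IsRCDVS P f B τ x₀ K S x) (hB : B.PosSemidef)
    (hf : IsOneSmooth f B) (k : Fin (K + 1)) (ω : Ω) : x k ω ∈ sublevelSet f x₀ := by
  induction k using Fin.induction with
  | zero => rw [h.start]; exact le_refl (f x₀)
  | succ k ih =>
    rw [h.step]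
    exact (hf.coordStep_le_self hB _ _).trans ih

theorem integrable_comp_of_mem_sublevelSet [IsFiniteMeasure P] (hf : Continuous f)
    (hbdd : Bornology.IsBounded (sublevelSet f x₀)) {y : Ω → EuclideanSpace ℝ (Fin n)}
    (hym : AEStronglyMeasurable (fun ω => f (y ω)) P) (hy : ∀ ω, y ω ∈ sublevelSet f x₀) :
    Integrable (fun ω => f (y ω)) P := by
  obtain ⟨C, hC⟩ := (isCompact_sublevelSet hf hbdd).exists_bound_of_continuousOn hf.continuousOn
  exact Integrable.of_bound hym C (ae_of_all _ fun ω => hC _ (hy ω))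

/-- No measurability of `φ` is needed: the iterate factors through finitely many samples with values
in a finite discrete space. -/
theorem IsRCDVS.measurable_comp (h : IsRCDVS P f B τ x₀ K S x) (k : Fin (K + 1))
    (φ : EuclideanSpace ℝ (Fin n) → ℝ) : Measurable fun ω => φ (x k ω) := by
  obtain ⟨G, hG⟩ := h.exists_eq_comp k
  simp only [hG]
  exact (Measurable.of_discrete (f := fun s => φ (G s))).comp
    (measurable_pi_lambda _ fun j => (h.sample j).measurable)

/-- The iterate depends only on samples with index below k, a block disjoint from {k}. -/
theorem IsRCDVS.indepFun_comp (h : IsRCDVS P f B τ x₀ K S x) (k : Fin K)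
    (ψ : TauSubset n τ → ℝ) (φ : EuclideanSpace ℝ (Fin n) → ℝ) :
    IndepFun (fun ω => ψ (S k ω)) (fun ω => φ (x k.castSucc ω)) P := by
  obtain ⟨G, hG⟩ := h.exists_eq_comp k.castSucc
  have hi := h.indep.indepFun_finset {k} (Finset.univ.filter fun j : Fin K => j.val < k.castSucc.val)
    (by simp) fun j => (h.sample j).measurable
  simp only [hG]
  exact hi.comp (φ := fun s => ψ (s ⟨k, by simp⟩)) (ψ := fun s => φ (G s)) Measurable.of_discrete
    Measurable.of_discrete

theorem IsRCDVS.integrable [IsProbabilityMeasure P] (h : IsRCDVS P f B τ x₀ K S x)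
    (hB : B.PosSemidef) (hf : IsOneSmooth f B) (hbdd : Bornology.IsBounded (sublevelSet f x₀))
    (k : Fin (K + 1)) : Integrable (fun ω => f (x k ω)) P :=
  integrable_comp_of_mem_sublevelSet hf.differentiable.continuous hbdd
    (h.measurable_comp k f).aestronglyMeasurable (h.mem_sublevelSet hB hf k)

theorem IsRCDVS.integrable_coordStep [IsProbabilityMeasure P] (h : IsRCDVS P f B τ x₀ K S x)
    (hB : B.PosSemidef) (hf : IsOneSmooth f B) (hbdd : Bornology.IsBounded (sublevelSet f x₀))
    (k : Fin (K + 1)) (T : TauSubset n τ) :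
    Integrable (fun ω => f (coordStep f B T.1 (x k ω))) P :=
  integrable_comp_of_mem_sublevelSet hf.differentiable.continuous hbdd
    (h.measurable_comp k fun y => f (coordStep f B T.1 y)).aestronglyMeasurable
    fun ω => (hf.coordStep_le_self hB T.1 _).trans (h.mem_sublevelSet hB hf k ω)

/-- Split by the value of the current sample: each indicator is independent of the current iterate,
so the integral of the product factors, and the indicator integrates to the sampling probability.
This replaces conditional expectation. -/
theorem IsRCDVS.integral_succ [IsProbabilityMeasure P] (h : IsRCDVS P f B τ x₀ K S x)
    (hB : B.PosSemidef) (hf : IsOneSmooth f B) (hbdd : Bornology.IsBounded (sublevelSet f x₀))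
    (k : Fin K) :
    ∫ ω, f (x k.succ ω) ∂P = ∫ ω, ∑ T : TauSubset n τ,
      (principalSubmatrix B T.1).det / sumMinors B τ * f (coordStep f B T.1 (x k.castSucc ω)) ∂P := by
  classical
  have hint := h.integrable_coordStep hB hf hbdd k.castSucc
  have hsplit : ∀ ω, f (x k.succ ω) = ∑ T : TauSubset n τ,
      (if S k ω = T then (1 : ℝ) else 0) * f (coordStep f B T.1 (x k.castSucc ω)) := by
    intro ω
    rw [h.step]
    simp
  have hmS : ∀ T, MeasurableSet {ω | S k ω = T} := fun T =>
    (h.sample k).measurable (measurableSet_singleton T)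
  have hmI : ∀ T, AEStronglyMeasurable (fun ω => if S k ω = T then (1 : ℝ) else 0) P := fun T =>
    (Measurable.ite (hmS T) measurable_const measurable_const).aestronglyMeasurable
  simp_rw [hsplit]
  rw [integral_finsetSum _ fun T _ => (hint T).const_mul _, integral_finsetSum]
  · refine Finset.sum_congr rfl fun T _ => ?_
    have hind := h.indepFun_comp k (fun U => if U = T then (1 : ℝ) else 0)
      fun y => f (coordStep f B T.1 y)
    rw [hind.integral_fun_mul_eq_mul_integral (hmI T) (hint T).aestronglyMeasurable,
      integral_const_mul]
    congr 1
    have : (fun ω => if S k ω = T then (1 : ℝ) else 0) = {ω | S k ω = T}.indicator 1 := by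
      funext ω
      simp [Set.indicator]
    rw [this, integral_indicator_one (hmS T), (h.sample k).law T, sumMinors]
  · intro T _
    refine (hint T).bdd_mul (c := 1) (hmI T) (ae_of_all _ fun ω => ?_)
    split_ifs <;> simp

end Iterates

/-! ### The convergence rate. -/

theorem theorem3p7 {n : ℕ} (f : EuclideanSpace ℝ (Fin n) → ℝ) (B : Matrix (Fin n) (Fin n) ℝ)
    (hB : B.PosSemidef) (hconv : ConvexOn ℝ Set.univ f) (hsmooth : IsOneSmooth f B)
    (x₀ : EuclideanSpace ℝ (Fin n)) (hbdd : Bornology.IsBounded (sublevelSet f x₀))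
    (τ : ℕ) (hτ : 1 ≤ τ) (hτB : τ ≤ B.rank) :
    -- the minima and the maximum in the claim are attained
    IsLeast (Set.range f) (minValue f) ∧
    (∀ x, IsLeast ((fun z => matSeminorm (tauApprox hB.isHermitian τ) (x - z)) '' argminSet f)
      (distToArgmin f (tauApprox hB.isHermitian τ) x)) ∧
    IsGreatest (distToArgmin f (tauApprox hB.isHermitian τ) '' sublevelSet f x₀)
      (sublevelRadius f (tauApprox hB.isHermitian τ) x₀) ∧
    -- the convergence rate
    ∀ {Ω : Type*} [MeasurableSpace Ω] (P : Measure Ω) [IsProbabilityMeasure P]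
      (K : ℕ) (_ : 1 ≤ K) (S : Fin K → Ω → TauSubset n τ)
      (x : Fin (K + 1) → Ω → EuclideanSpace ℝ (Fin n)) (_ : IsRCDVS P f B τ x₀ K S x)
      (k : Fin (K + 1)),
      Integrable (fun ω => f (x k ω)) P ∧
      (∫ ω, f (x k ω) ∂P) - minValue f
        ≤ 2 * sublevelRadius f (tauApprox hB.isHermitian τ) x₀ ^ 2 / (((k : ℕ) : ℝ) + 1) := by
  have hcont := hsmooth.differentiable.continuous
  obtain ⟨z, hz⟩ := argminSet_nonempty hcont hbdd
  refine ⟨isLeast_minValue hz, fun x => isLeast_distToArgmin hcont hbdd _ x,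
    isGreatest_sublevelRadius hcont hbdd _, ?_⟩
  intro Ω _ P _ K hK S x h k
  have hint := h.integrable hB hsmooth hbdd
  have hintT := h.integrable_coordStep hB hsmooth hbdd
  have hZ : 0 < sumMinors B τ := (h.sample ⟨0, hK⟩).sumMinors_pos hB
  refine ⟨hint k, ?_⟩
  set C := 2 * sublevelRadius f (tauApprox hB.isHermitian τ) x₀ ^ 2 with hC
  have hmono : ∀ k : Fin K, ∫ ω, f (x k.succ ω) ∂P ≤ ∫ ω, f (x k.castSucc ω) ∂P := fun k =>
    integral_mono (hint _) (hint _) fun ω => by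
      simp only [h.step]
      exact hsmooth.coordStep_le_self hB _ _
  have hlow : ∀ k, minValue f ≤ ∫ ω, f (x k ω) ∂P := by
    intro k
    calc minValue f = ∫ _, minValue f ∂P := by simp
      _ ≤ _ := integral_mono (integrable_const _) (hint k) fun ω =>
          (isLeast_minValue hz).2 ⟨x k ω, rfl⟩
  have hstep : ∀ k : Fin K, ((∫ ω, f (x k.castSucc ω) ∂P) - minValue f) ^ 2 ≤
      C * (((∫ ω, f (x k.castSucc ω) ∂P) - minValue f) - ((∫ ω, f (x k.succ ω) ∂P) - minValue f)) := by
    intro k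
    set m := ∫ ω, f (x k.castSucc ω) ∂P with hm
    have hsum : Integrable (fun ω => ∑ T : TauSubset n τ, (principalSubmatrix B T.1).det /
        sumMinors B τ * f (coordStep f B T.1 (x k.castSucc ω))) P :=
      integrable_finsetSum _ fun T _ => (hintT _ T).const_mul _
    have hdev : Integrable
        (fun ω => 2 * (m - minValue f) * (f (x k.castSucc ω) - m)) P :=
      ((hint k.castSucc).sub (integrable_const m)).const_mul _
    -- the tangent line of the square at the mean replaces Jensen's inequality
    have hpt : ∀ ω, (m - minValue f) ^ 2 + 2 * (m - minValue f) * (f (x k.castSucc ω) - m) ≤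
        C * (f (x k.castSucc ω) - ∑ T : TauSubset n τ, (principalSubmatrix B T.1).det /
          sumMinors B τ * f (coordStep f B T.1 (x k.castSucc ω))) := by
      intro ω
      refine le_trans ?_ (sq_sub_minValue_le hB hconv hsmooth hbdd hτ hZ
        (h.mem_sublevelSet hB hsmooth k.castSucc ω))
      nlinarith [sq_nonneg (f (x k.castSucc ω) - m)]
    have hmean := integral_mono (μ := P)
      ((integrable_const _).add hdev)
      (((hint k.castSucc).sub hsum).const_mul C) hpt
    simp only [Pi.add_apply, Pi.sub_apply] at hmean
    rw [integral_add (integrable_const _) hdev, integral_const_mul, integral_const_mul, integral_sub (hint _) (integrable_const _), integral_sub (hint _) hsum,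
      ← h.integral_succ hB hsmooth hbdd] at hmean
    -- The linear term of the tangent integrates to zero because m is the mean.
    simp only [integral_const, probReal_univ, one_smul, ← hm, sub_self, mul_zero, add_zero] at hmean
    linarith
  refine le_div_of_sq_le_mul_sub (fun k => (∫ ω, f (x k ω) ∂P) - minValue f) (by positivity) ?_
    (fun k => sub_le_sub_right (hmono k) _) hstep k
  -- The base bound a_0 ≤ C comes from the recursion itself: a_0² ≤ C (a_0 - a_1) ≤ C a_0, where K ≥
  -- 1 supplies the first step.
  have h0 := hstep ⟨0, hK⟩
  have h1 := hlow (Fin.succ ⟨0, hK⟩)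
  have h2 := hlow 0
  have hcast : (Fin.castSucc ⟨0, hK⟩ : Fin (K + 1)) = 0 := rfl
  rw [hcast] at h0
  have hCnn : 0 ≤ C := by positivity
  rcases h2.eq_or_lt with he | hlt
  · simp only [← he, sub_self]
    exact hCnn
  · have hpos : 0 < (∫ ω, f (x 0 ω) ∂P) - minValue f := sub_pos.mpr hlt
    refine le_of_mul_le_mul_right ?_ hpos
    have := mul_nonneg hCnn (sub_nonneg.mpr h1)
    nlinarith
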